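/- Let $h_{\mathrm{SR}},h_{\mathrm{RU}}$ be independent complex random variables. Let $b_s>0$, $\Omega_{sr}\ge 0$, let $\Gamma_s\ge 1$ be an integer, and put $$\alpha=\frac1{2b_s}\Big(\frac{2b_s\Gamma_s}{2b_s\Gamma_s+\Omega_{sr}}\Big)^{\Gamma_s},\qquad \beta=\frac1{2b_s},\qquad \delta=\frac{\Omega_{sr}}{2b_s(2b_s\Gamma_s+\Omega_{sr})}.$$ Assume that $|h_{\mathrm{SR}}|^2$ is shadowed-Rician, i.e. has density $\alpha e^{-\beta x}\,{}_1F_1(\Gamma_s;1;\delta x)$ for $x>0$ and $0$ otherwise, and that $|h_{\mathrm{RU}}|$ is Fisher–Snedecor $\mathcal F$, i.e. for some $m,m_s,\Omega_m,\Omega_s>0$ it has density $$\frac{2(m\Omega_s)^m(m_s\Omega_m)^{m_s}x^{2m-1}}{B(m,m_s)\,[m\Omega_s x^2+m_s\Omega_m]^{m+m_s}}$$ for $x>0$ and $0$ otherwise. Let $\bar\gamma_{\mathrm{SR}},\bar\gamma_{\mathrm{RU}},C>0$ be constants and $$\gamma_{\mathrm{SR}}=\bar\gamma_{\mathrm{SR}}|h_{\mathrm{SR}}|^2,\qquad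 \gamma_{\mathrm{RU}}=\bar\gamma_{\mathrm{RU}}|h_{\mathrm{RU}}|^2,\qquad \gamma_{\mathrm{AF}}=\frac{\gamma_{\mathrm{SR}}\gamma_{\mathrm{RU}}}{\gamma_{\mathrm{RU}}+C}.$$ Put $c_k=\frac{(-1)^k(1-\Gamma_s)_{k}\,\delta^k}{(k!)^2}$, where $(x)_k=x(x+1)\cdots(x+k-1)$, and let $\Upsilon(a,x)=\int_0^x t^{a-1}e^{-t}\,dt$. Then for every $\gamma>0$ the CDF of $\gamma_{\mathrm{SR}}$ is $$F_{\gamma_{\mathrm{SR}}}(\gamma)=\alpha\sum_{k=0}^{\Gamma_s-1}\frac{c_k}{(\beta-\delta)^{k+1}}\,\Upsilon\Big(k+1,\frac{(\beta-\delta)\gamma}{\bar\gamma_{\mathrm{SR}}}\Big),$$ and the CDF of $\gamma_{\mathrm{AF}}$ is $$F_{\gamma_{\mathrm{AF}}}(\gamma)=F_{\gamma_{\mathrm{SR}}}(\gamma)+\Lambda\sum_{k=0}^{\Gamma_s-1}\frac{c_k}{\bar\gamma_{\mathrm{SR}}^{\,k+1}}\sum_{i=0}^{k}\binom ki\Big(\frac{\beta-\delta}{\bar\gamma_{\mathrm{SR}}}\Big)^{-(i+1)}\gamma^{k-i}\,G^{2,2}_{3,2}\!\left(\frac{m_s\Omega_m\bar\gamma_{\mathrm{SR}}\bar\gamma_{\mathrm{RU}}}{(\beta-\delta)\,m\,\Omega_s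 C\gamma}\,\middle|\,\begin{matrix}-i,\;1-m,\;1\\ m_s,\;0\end{matrix}\right),$$ where $\Lambda=\dfrac{\alpha\, e^{-(\beta-\delta)\gamma/\bar\gamma_{\mathrm{SR}}}}{\Gamma(m)\Gamma(m_s)}$. Here the Meijer function is, for $z>0$, the absolutely convergent integral $$G^{2,2}_{3,2}\!\left(z\,\middle|\,\begin{matrix}-i,\,1-m,\,1\\ m_s,\,0\end{matrix}\right)=\frac1{2\pi \mathrm{i}}\int_{c-\mathrm{i}\infty}^{c+\mathrm{i}\infty}\frac{\Gamma(m_s-s)\,\Gamma(-s)\,\Gamma(1+i+s)\,\Gamma(m+s)}{\Gamma(1-s)}\,z^s\,ds$$ along any vertical line with $\max(-m,-i-1)<c<0$ (its value does not depend on $c$); $\mathrm{i}$ denotes the imaginary unit and $i$ the summation index. -/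

import Mathlib

open MeasureTheory ProbabilityTheory

noncomputable section

namespace Relay

/-! ### Special functions -/

/-- Kummer's confluent hypergeometric function `₁F₁(a; b; x) = ∑ₙ (a)ₙ / (b)ₙ · xⁿ / n!`. -/
def kummer (a b x : ℝ) : ℝ :=
  ∑' n : ℕ, (ascPochhammer ℝ n).eval a / ((ascPochhammer ℝ n).eval b * (n.factorial : ℝ)) * x ^ n

/-- The lower incomplete gamma function `∫₀ˣ t^(a-1) e^(-t) dt`. -/
def lowerGamma (a x : ℝ) : ℝ := ∫ t in (0 : ℝ)..x, t ^ (a - 1) * Real.exp (-t)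

/-- The Mellin–Barnes integrand of the Meijer function `G^{m,n}_{p,q}(z | a; b)`:
`∏_{j ≤ m} Γ(b_j - s) ∏_{j ≤ n} Γ(1 - a_j + s) z^s
  / (∏_{j > m} Γ(1 - b_j + s) ∏_{j > n} Γ(a_j - s))`.
Since `Complex.Gamma` vanishes at its poles and `x / 0 = 0`, the denominators are the
entire function `1 / Γ`. -/
def meijerIntegrand {p q : ℕ} (m n : ℕ) (a : Fin p → ℂ) (b : Fin q → ℂ) (z s : ℂ) : ℂ :=
  (∏ j with j.val < m, Complex.Gamma (b j - s)) * (∏ j with j.val < n, Complex.Gamma (1 - a j + s))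
    / ((∏ j with m ≤ j.val, Complex.Gamma (1 - b j + s))
        * (∏ j with n ≤ j.val, Complex.Gamma (a j - s))) * z ^ s

/-- The vertical line `Re s = c` separates the poles `a_j - 1 - l` (`j ≤ n`, `l ∈ ℕ`), which lie to
its left, from the poles `b_j + l` (`j ≤ m`, `l ∈ ℕ`), which lie to its right. -/
def Separates {p q : ℕ} (m n : ℕ) (a : Fin p → ℂ) (b : Fin q → ℂ) (c : ℝ) : Prop :=
  (∀ j : Fin p, j.val < n → ∀ l : ℕ, (a j - 1 - l).re < c) ∧
    (∀ j : Fin q, j.val < m → ∀ l : ℕ, c < (b j + l).re)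

/-- `(1 / 2πi) ∫ G-integrand ds` along the line `Re s = c`, directed upwards (`ds = i dy`). -/
def meijerLine {p q : ℕ} (m n : ℕ) (a : Fin p → ℂ) (b : Fin q → ℂ) (z : ℂ) (c : ℝ) : ℂ :=
  (1 / (2 * (Real.pi : ℂ))) * ∫ y : ℝ, meijerIntegrand m n a b z ((c : ℂ) + (y : ℂ) * Complex.I)

open Classical in
/-- The Meijer function `G^{m,n}_{p,q}(z | a; b)`, for parameters whose two families of poles can be
separated by a vertical line: the Mellin–Barnes integral along such a line. (The value `0` is
a default when there is no such line.) -/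
def meijerG {p q : ℕ} (m n : ℕ) (a : Fin p → ℂ) (b : Fin q → ℂ) (z : ℂ) : ℂ :=
  if h : ∃ c : ℝ, Separates m n a b c then meijerLine m n a b z h.choose else 0

/-- `G^{m,n}_{p,q}(z | a; b)` is well defined by its Mellin–Barnes integral: there is a separating
vertical line, the integral converges absolutely along every such line, and its value is always
`meijerG`. -/
def MeijerGWellDefined {p q : ℕ} (m n : ℕ) (a : Fin p → ℂ) (b : Fin q → ℂ) (z : ℂ) : Prop :=
  (∃ c : ℝ, Separates m n a b c) ∧
    ∀ c : ℝ, Separates m n a b c →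
      Integrable (fun y : ℝ => meijerIntegrand m n a b z ((c : ℂ) + (y : ℂ) * Complex.I)) ∧
        meijerLine m n a b z c = meijerG m n a b z

/-! ### Shadowed-Rician fading

`2 * b` is the mean power of the multipath component, `Ωsr` that of the line-of-sight component,
and `Γs` is the Nakagami parameter. -/

def alphaSR (b Γs Ωsr : ℝ) : ℝ := 1 / (2 * b) * (2 * b * Γs / (2 * b * Γs + Ωsr)) ^ Γs

def betaSR (b : ℝ) : ℝ := 1 / (2 * b)

def deltaSR (b Γs Ωsr : ℝ) : ℝ := Ωsr / (2 * b * (2 * b * Γs + Ωsr))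

/-- The density of the shadowed-Rician channel power gain. -/
def shadowedRicianPDF (b Γs Ωsr x : ℝ) : ℝ :=
  if 0 < x then
    alphaSR b Γs Ωsr * Real.exp (-betaSR b * x) * kummer Γs 1 (deltaSR b Γs Ωsr * x)
  else 0

/-- The law of the shadowed-Rician channel power gain. -/
def shadowedRicianLaw (b Γs Ωsr : ℝ) : Measure ℝ :=
  volume.withDensity fun x => ENNReal.ofReal (shadowedRicianPDF b Γs Ωsr x)

/-! ### Fisher–Snedecor `F` fading -/

/-- The density of the Fisher–Snedecor `F` channel envelope. -/
def fisherPDF (m ms Ωm Ωs x : ℝ) : ℝ :=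
  if 0 < x then
    2 * (m * Ωs) ^ m * (ms * Ωm) ^ ms * x ^ (2 * m - 1)
      / (ProbabilityTheory.beta m ms * (m * Ωs * x ^ 2 + ms * Ωm) ^ (m + ms))
  else 0

/-- The law of the Fisher–Snedecor `F` channel envelope. -/
def fisherLaw (m ms Ωm Ωs : ℝ) : Measure ℝ :=
  volume.withDensity fun x => ENNReal.ofReal (fisherPDF m ms Ωm Ωs x)

/-! ### The signal-to-noise ratios -/

/-- Received SNR of a link with average transmit SNR `γbar` and channel coefficient `h`. -/
def linkSNR (γbar : ℝ) (h : ℂ) : ℝ := γbar * ‖h‖ ^ 2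

/-- End-to-end SNR of fixed-gain amplify-and-forward relaying. -/
def snrAF (C γSR γRU : ℝ) : ℝ := γSR * γRU / (γRU + C)

/-! ### The closed-form expressions -/

/-- `c_k = (-1)^k (1 - Γs)_k δ^k / (k!)²`. -/
def coeffC (b Γs Ωsr : ℝ) (k : ℕ) : ℝ :=
  (-1) ^ k * (ascPochhammer ℝ k).eval (1 - Γs) * deltaSR b Γs Ωsr ^ k / (k.factorial : ℝ) ^ 2

/-- The closed form of the CDF of the SNR of the first link. -/
def closedFormSR (b : ℝ) (Γs : ℕ) (Ωsr γbarSR γ : ℝ) : ℝ :=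
  alphaSR b Γs Ωsr * ∑ k ∈ Finset.range Γs,
    coeffC b Γs Ωsr k / (betaSR b - deltaSR b Γs Ωsr) ^ (k + 1)
      * lowerGamma ((k : ℝ) + 1) ((betaSR b - deltaSR b Γs Ωsr) * γ / γbarSR)

/-- The factor `Λ`, a function of the threshold `γ`. -/
def lambdaAF (b Γs Ωsr γbarSR m ms γ : ℝ) : ℝ :=
  alphaSR b Γs Ωsr * Real.exp (-((betaSR b - deltaSR b Γs Ωsr) * γ / γbarSR))
    / (Real.Gamma m * Real.Gamma ms)

/-- The upper parameters `-i, 1 - m, 1` of the Meijer function. -/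
def upperParams (m : ℝ) (i : ℕ) : Fin 3 → ℂ := ![-(i : ℂ), 1 - (m : ℂ), 1]

/-- The lower parameters `m_s, 0` of the Meijer function. -/
def lowerParams (ms : ℝ) : Fin 2 → ℂ := ![(ms : ℂ), 0]

/-- The argument of the Meijer function. -/
def meijerArg (b Γs Ωsr γbarSR m ms Ωm Ωs γbarRU C γ : ℝ) : ℝ :=
  ms * Ωm * γbarSR * γbarRU / ((betaSR b - deltaSR b Γs Ωsr) * m * Ωs * C * γ)

end Relay

end

namespace Relay

open Complex Set

/-! ### Kummer's transformation for an integral first parameter -/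

/-! Since `Γs` is an integer, Kummer's transformation (`kummer_natCast_add_one`) turns the
shadowed-Rician density into `α e^(-κx) ∑ cₖ xᵏ` with `κ = β - δ` and finitely many terms.
Integrating it over `(0, γ/γbarSR]` term by term gives the first distribution function.

For the relay, `γ_AF ≤ γ` means `(γ_SR - γ) γ_RU ≤ γ C` (`snrAF_le_iff`). This is automatic when
`γ_SR ≤ γ`, which contributes the summand `F_SR(γ)`. Beyond `g = γ/γbarSR`, put `x = g + u/κ`: the
exponential factors, the binomial theorem splits `xᵏ` into powers `uⁱ`, and the event becomes `w u ≤
1/z`, where `w` is the normalised squared Fisher envelope and `z` the Meijer argument. What remains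
is the mass of `{w u ≤ 1/z}` under the Fisher law times `uⁱ e⁻ᵘ du`
(`setIntegral_Ioi_exp_mul_poly_mul`, `measureReal_prod_snrAF_le`).

This mass is a Meijer function up to the factor `Γ(m) Γ(ms)` (`meijerLine_eq`). The Mellin transform
of the distribution function of `Y = w u` is `-(1/s) ∫ Yˢ` for `Re s < 0`; the moments of `w` and
`u` are gamma products, and `-1/s = Γ(-s)/Γ(1-s)`, so the Mellin–Barnes integrand appears and Mellin
inversion at `1/z` applies. The result does not involve the abscissa, which proves independence of
the line. -/

lemma neg_one_pow_mul_ascPochhammer_eval_neg (N k : ℕ) :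
    (-1 : ℝ) ^ k * (ascPochhammer ℝ k).eval (-(N : ℝ)) = k.factorial * N.choose k := by
  rw [ascPochhammer_eval_neg_eq_descPochhammer, descPochhammer_eval_eq_descFactorial,
    Nat.descFactorial_eq_factorial_mul_choose, ← mul_assoc, ← mul_pow]
  simp

/-- Kummer's transformation `₁F₁(N + 1; 1; x) = eˣ ₁F₁(-N; 1; -x)`, whose right-hand side
is a polynomial times an exponential. -/
lemma kummer_natCast_add_one (N : ℕ) (x : ℝ) :
    kummer ((N : ℝ) + 1) 1 x =
      Real.exp x * ∑ k ∈ Finset.range (N + 1), (N.choose k : ℝ) / k.factorial * x ^ k := by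
  set f : ℕ → ℝ := fun k => (N.choose k : ℝ) / k.factorial * x ^ k with hf
  set g : ℕ → ℝ := fun n => x ^ n / n.factorial with hg
  have hsupp : ∀ k ∉ Finset.range (N + 1), f k = 0 := by
    intro k hk
    rw [Finset.mem_range, not_lt] at hk
    simp [hf, Nat.choose_eq_zero_of_lt hk]
  have hfs : Summable fun k => ‖f k‖ :=
    summable_of_ne_finset_zero (s := Finset.range (N + 1)) fun k hk => by simp [hsupp k hk]
  have hgs : Summable fun k => ‖g k‖ := by
    simpa [hg, norm_div] using Real.summable_pow_div_factorial ‖x‖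
  -- The polynomial is padded with zeros to a series, so that its product with `eˣ` is a Cauchy
  -- product, to be compared coefficient by coefficient.
  rw [← tsum_eq_sum (L := .unconditional ℕ) hsupp, Real.exp_eq_exp_ℝ, NormedSpace.exp_eq_tsum_div, mul_comm,
    tsum_mul_tsum_eq_tsum_sum_antidiagonal_of_summable_norm hfs hgs, kummer]
  refine tsum_congr fun n => ?_
  have h1 : (ascPochhammer ℝ n).eval ((N : ℝ) + 1) = n.factorial * (N + n).choose n := by
    have := ascPochhammer_nat_eq_ascFactorial (N + 1) n
    rw [Nat.ascFactorial_eq_factorial_mul_choose] at this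
    have h2 := congrArg (Nat.cast : ℕ → ℝ) this
    rw [ascPochhammer_eval_cast] at h2
    push_cast at h2
    exact h2
  -- Vandermonde's identity.
  have h3 : (((N + n).choose n : ℕ) : ℝ) =
      ∑ p ∈ Finset.HasAntidiagonal.antidiagonal n, (N.choose p.1 : ℝ) * n.choose p.2 := by
    rw [Nat.add_choose_eq]; push_cast; rfl
  rw [h1, ascPochhammer_eval_one, h3, Finset.mul_sum, Finset.sum_div, Finset.sum_mul]
  refine Finset.sum_congr rfl fun p hp => ?_
  rw [Finset.HasAntidiagonal.mem_antidiagonal] at hp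
  have h4 : (n.choose p.2 : ℝ) = n.factorial / (p.2.factorial * p.1.factorial) := by
    rw [Nat.cast_choose ℝ (by omega : p.2 ≤ n), show n - p.2 = p.1 by omega]
  have hn : (n.factorial : ℝ) ≠ 0 := by exact_mod_cast n.factorial_ne_zero
  rw [h4, hf, hg, ← hp, pow_add]
  rw [← hp] at hn
  have h5 : (p.1.factorial : ℝ) ≠ 0 := by exact_mod_cast p.1.factorial_ne_zero
  have h6 : (p.2.factorial : ℝ) ≠ 0 := by exact_mod_cast p.2.factorial_ne_zero
  field_simp

/-! ### The beta integral over the half-line -/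

lemma image_div_one_sub_Ioo : (fun y : ℝ => y / (1 - y)) '' Ioo 0 1 = Ioi 0 := by
  ext x
  constructor
  · rintro ⟨y, ⟨h0, h1⟩, rfl⟩
    exact div_pos h0 (by linarith)
  · intro hx
    rw [mem_Ioi] at hx
    refine ⟨x / (1 + x), ⟨by positivity, (div_lt_one (by positivity)).2 (by linarith)⟩, ?_⟩
    field_simp
    ring

/-- Euler's beta integral of the second kind. -/
lemma integral_Ioi_cpow_div_one_add_cpow (u v : ℂ) :
    ∫ x in Ioi (0 : ℝ), (x : ℂ) ^ (u - 1) / ((1 + x : ℝ) : ℂ) ^ (u + v) = betaIntegral u v := by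
  have hd : ∀ y ∈ Ioo (0 : ℝ) 1,
      HasDerivWithinAt (fun y : ℝ => y / (1 - y)) (1 / (1 - y) ^ 2) (Ioo 0 1) y := by
    intro y hy
    have h1 : 1 - y ≠ 0 := by linarith [hy.2]
    have := ((hasDerivAt_id y).div ((hasDerivAt_id y).const_sub 1) h1).hasDerivWithinAt
      (s := Ioo (0 : ℝ) 1)
    refine this.congr_deriv ?_
    simp
  have hinj : InjOn (fun y : ℝ => y / (1 - y)) (Ioo 0 1) := by
    intro y hy z hz h
    have h1 : 1 - y ≠ 0 := by linarith [hy.2]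
    have h2 : 1 - z ≠ 0 := by linarith [hz.2]
    have := (div_eq_div_iff h1 h2).1 h
    linarith
  -- The substitution `x = y/(1-y)`, under which `1 + x = 1/(1-y)`, reduces to the beta integral
  -- over `(0,1)`.
  rw [← image_div_one_sub_Ioo, integral_image_eq_integral_abs_deriv_smul measurableSet_Ioo hd hinj,
    betaIntegral, intervalIntegral.integral_of_le zero_le_one, integral_Ioc_eq_integral_Ioo]
  refine setIntegral_congr_fun measurableSet_Ioo fun y hy => ?_
  have h0 : 0 < y := hy.1
  have h1 : 0 < 1 - y := by linarith [hy.2]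
  have h1' : ((1 - y : ℝ) : ℂ) ≠ 0 := by exact_mod_cast h1.ne'
  have e1 : 1 + y / (1 - y) = (1 - y)⁻¹ := by field_simp; ring
  have e2 : ((1 - y : ℝ) : ℂ) ^ (v - 1) = ((1 - y : ℝ) : ℂ) ^ (u + v) / ((1 - y : ℝ) : ℂ) ^ (u - 1)
      / ((1 - y : ℝ) : ℂ) ^ 2 := by
    rw [← cpow_sub _ _ h1', ← cpow_natCast, ← cpow_sub _ _ h1']
    congr 1
    push_cast
    ring
  have hx : (1 : ℂ) - y = ((1 - y : ℝ) : ℂ) := by push_cast; rfl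
  rw [hx, e1, e2, abs_of_pos (by positivity), div_eq_mul_inv y, ofReal_mul,
    mul_cpow_ofReal_nonneg h0.le (by positivity), ofReal_inv,
    inv_cpow _ _ (by rw [arg_ofReal_of_nonneg h1.le]; exact Real.pi_pos.ne),
    inv_cpow _ _ (by rw [arg_ofReal_of_nonneg h1.le]; exact Real.pi_pos.ne), real_smul]
  push_cast
  have h5 : (1 - (y : ℂ)) ^ (u - 1) ≠ 0 := by
    rw [hx]; exact fun h => h1' (cpow_eq_zero_iff _ _ |>.1 h).1
  have h6 : (1 - (y : ℂ)) ^ (u + v) ≠ 0 := by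
    rw [hx]; exact fun h => h1' (cpow_eq_zero_iff _ _ |>.1 h).1
  rw [← hx] at h1'
  field_simp

/-! ### Bounds for the gamma function on vertical lines -/

lemma norm_Gamma_le_Gamma_re {z : ℂ} (hz : 0 < z.re) : ‖Complex.Gamma z‖ ≤ Real.Gamma z.re := by
  rw [Complex.Gamma_eq_integral hz, Real.Gamma_eq_integral hz, Complex.GammaIntegral]
  refine (norm_integral_le_integral_norm _).trans (le_of_eq ?_)
  refine setIntegral_congr_fun measurableSet_Ioi fun x hx => ?_
  rw [norm_mul, norm_cpow_eq_rpow_re_of_pos hx, norm_real, Real.norm_of_nonneg (Real.exp_pos _).le]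
  simp

/-- The functional equation `Γ(z+1) = z Γ(z)` gains one power of decay along vertical lines; with
the factor `1/s` this makes two, enough for integrability without Stirling's formula. -/
lemma norm_Gamma_le_Gamma_re_add_one_div {z : ℂ} (hz : 0 < z.re) :
    ‖Complex.Gamma z‖ ≤ Real.Gamma (z.re + 1) / ‖z‖ := by
  have h0 : z ≠ 0 := by rintro rfl; simp at hz
  rw [le_div_iff₀ (norm_pos_iff.2 h0), mul_comm, ← norm_mul, ← Complex.Gamma_add_one z h0]
  simpa using norm_Gamma_le_Gamma_re (z := z + 1) (by simp; linarith)

/-! ### The Mellin transform of a distribution function -/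

/-- Fubini: with `μ{Y ≤ x}` written as the integral of an indicator, the inner integral is `∫_Y^∞
x^(s-1) dx = -Yˢ/s`, convergent because `Re s < 0`. The moment of order `Re s` supplies absolute
convergence. -/
lemma hasMellin_measureReal_le {α : Type*} [MeasurableSpace α] (μ : Measure α) [IsFiniteMeasure μ]
    {Y : α → ℝ} (hY : Measurable Y) (hpos : ∀ᵐ a ∂μ, 0 < Y a) {s : ℂ} (hs : s.re < 0)
    (hint : Integrable (fun a => Y a ^ s.re) μ) :
    HasMellin (fun x => (μ.real {a | Y a ≤ x} : ℂ)) s (-(1 / s) * ∫ a, (Y a : ℂ) ^ s ∂μ) := by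
  have hs0 : s ≠ 0 := by rintro rfl; simp at hs
  set F : ℝ → α → ℂ := fun x a => {p : ℝ × α | Y p.2 ≤ p.1}.indicator
    (fun p => (p.1 : ℂ) ^ (s - 1)) (x, a) with hF
  have hset : MeasurableSet {p : ℝ × α | Y p.2 ≤ p.1} :=
    measurableSet_le (hY.comp measurable_snd) measurable_fst
  have hmeas : Measurable (Function.uncurry F) := by
    refine Measurable.indicator ?_ hset
    fun_prop
  have hsec : ∀ a, 0 < Y a → (fun x => F x a) =
      (Ici (Y a)).indicator fun x : ℝ => (x : ℂ) ^ (s - 1) := by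
    intro a _
    ext x
    simp only [hF, indicator, mem_ofPred_eq, mem_Ici]
  have hre : (s - 1).re < -1 := by simp; linarith
  have hinter : ∀ a, 0 < Y a → Ici (Y a) ∩ Ioi 0 = Ici (Y a) := fun a ha =>
    inter_eq_left.2 fun x hx => lt_of_lt_of_le ha hx
  have hI : Integrable (Function.uncurry F) ((volume.restrict (Ioi (0 : ℝ))).prod μ) := by
    rw [integrable_prod_iff' hmeas.aestronglyMeasurable]
    constructor
    · filter_upwards [hpos] with a ha
      change Integrable (fun x => F x a) _
      rw [hsec a ha, integrable_indicator_iff measurableSet_Ici, IntegrableOn,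
        Measure.restrict_restrict measurableSet_Ici, hinter a ha]
      exact (integrableOn_Ici_iff_integrableOn_Ioi).2 (integrableOn_Ioi_cpow_of_lt hre ha)
    · refine (hint.const_mul (-(1 / s.re))).congr ?_
      filter_upwards [hpos] with a ha
      change _ = ∫ x, ‖F x a‖ ∂_
      have : (fun x => ‖F x a‖) = (Ici (Y a)).indicator fun x : ℝ => x ^ (s.re - 1) := by
        ext x
        have := congrFun (hsec a ha) x
        rw [this, norm_indicator_eq_indicator_norm]
        by_cases hx : x ∈ Ici (Y a)
        · rw [indicator_of_mem hx, indicator_of_mem hx,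
            norm_cpow_eq_rpow_re_of_pos (lt_of_lt_of_le ha hx)]
          simp
        · rw [indicator_of_notMem hx, indicator_of_notMem hx]
      rw [this, integral_indicator measurableSet_Ici, Measure.restrict_restrict measurableSet_Ici,
        hinter a ha, integral_Ici_eq_integral_Ioi, integral_Ioi_rpow_of_lt (by linarith) ha]
      simp only [sub_add_cancel]
      ring
  have hinner : ∀ x : ℝ, ∫ a, F x a ∂μ = (x : ℂ) ^ (s - 1) • (μ.real {a | Y a ≤ x} : ℂ) := by
    intro x
    have : (fun a => F x a) = {a | Y a ≤ x}.indicator fun _ => (x : ℂ) ^ (s - 1) := by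
      ext a
      simp only [hF, indicator, mem_ofPred_eq]
    rw [this, integral_indicator_const _ (measurableSet_le hY measurable_const), real_smul,
      smul_eq_mul, mul_comm]
  constructor
  · have := hI.integral_prod_left
    simpa only [MellinConvergent, IntegrableOn, Function.uncurry, hinner] using this
  · rw [mellin]
    simp only [← hinner]
    rw [integral_integral_swap hI, ← integral_const_mul]
    refine integral_congr_ae ?_
    filter_upwards [hpos] with a ha
    rw [hsec a ha, integral_indicator measurableSet_Ici, Measure.restrict_restrict measurableSet_Ici,
        hinter a ha, integral_Ici_eq_integral_Ioi, integral_Ioi_cpow_of_lt hre ha]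
    simp only [sub_add_cancel]
    field_simp

/-- Dominated convergence: as a function of the threshold, the indicator of `Y a ≤ x` jumps only at
`x = Y a`. -/
lemma continuousAt_measureReal_le {α : Type*} [MeasurableSpace α] (μ : Measure α)
    [IsFiniteMeasure μ] {Y : α → ℝ} (hY : Measurable Y) {x : ℝ} (hx : ∀ᵐ a ∂μ, Y a ≠ x) :
    ContinuousAt (fun x => μ.real {a | Y a ≤ x}) x := by
  have h : (fun x => μ.real {a | Y a ≤ x}) =
      fun x => ∫ a, {a | Y a ≤ x}.indicator (fun _ => (1 : ℝ)) a ∂μ := by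
    ext x
    rw [integral_indicator_const _ (measurableSet_le hY measurable_const)]
    simp
  rw [h]
  refine continuousAt_of_dominated (bound := fun _ => 1) ?_ ?_ (integrable_const _) ?_
  · exact .of_forall fun y => (measurable_const.indicator
      (measurableSet_le hY measurable_const)).aestronglyMeasurable
  · refine .of_forall fun y => .of_forall fun a => ?_
    rw [norm_indicator_eq_indicator_norm]
    exact indicator_le_self' (by simp) a |>.trans (by simp)
  · filter_upwards [hx] with a ha
    rcases lt_or_gt_of_ne ha with h | h
    · refine continuousAt_const.congr (f := fun _ => (1 : ℝ)) ?_
      filter_upwards [lt_mem_nhds h] with y hy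
      rw [indicator_of_mem]
      exact hy.le
    · refine continuousAt_const.congr (f := fun _ => (0 : ℝ)) ?_
      filter_upwards [gt_mem_nhds h] with y hy
      rw [indicator_of_notMem]
      exact not_le.2 hy

end Relay

namespace Relay

open Complex Set

/-! ### Moments of the Fisher–Snedecor law -/

lemma fisherPDF_nonneg {m ms Ωm Ωs : ℝ} (hm : 0 < m) (hms : 0 < ms) (hΩm : 0 < Ωm) (hΩs : 0 < Ωs)
    (x : ℝ) : 0 ≤ fisherPDF m ms Ωm Ωs x := by
  unfold fisherPDF
  split_ifs with h
  · have := beta_pos hm hms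
    positivity
  · exact le_rfl

lemma measurable_fisherPDF (m ms Ωm Ωs : ℝ) : Measurable (fisherPDF m ms Ωm Ωs) := by
  unfold fisherPDF
  refine Measurable.ite measurableSet_Ioi ?_ measurable_const
  fun_prop

lemma ae_fisherLaw_pos (m ms Ωm Ωs : ℝ) : ∀ᵐ r ∂fisherLaw m ms Ωm Ωs, 0 < r := by
  rw [fisherLaw, ae_withDensity_iff (measurable_fisherPDF m ms Ωm Ωs).ennreal_ofReal]
  refine .of_forall fun r hr => ?_
  by_contra h
  simp [fisherPDF, h] at hr

/-- In the variable `w = (mΩs/(msΩm)) x²`, with `dw = 2x (mΩs/(msΩm)) dx`, this is the beta prime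
density. -/
lemma fisherPDF_eq_of_pos {m ms Ωm Ωs x : ℝ} (hm : 0 < m) (hms : 0 < ms) (hΩm : 0 < Ωm)
    (hΩs : 0 < Ωs) (hx : 0 < x) :
    fisherPDF m ms Ωm Ωs x = 2 * x * (m * Ωs / (ms * Ωm)) * (beta m ms)⁻¹ *
      ((m * Ωs / (ms * Ωm) * x ^ 2) ^ (m - 1) / (1 + m * Ωs / (ms * Ωm) * x ^ 2) ^ (m + ms)) := by
  rw [fisherPDF, if_pos hx]
  have ha : 0 < m * Ωs := by positivity
  have hd : 0 < ms * Ωm := by positivity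
  generalize m * Ωs = a at *
  generalize ms * Ωm = d at *
  have e1 : 1 + a / d * x ^ 2 = (a * x ^ 2 + d) / d := by field_simp; ring
  have e2 : (a / d * x ^ 2) ^ (m - 1) = a ^ m / a / (d ^ m / d) * (x ^ (2 * m - 1) / x) := by
    rw [Real.mul_rpow (by positivity) (by positivity), Real.div_rpow ha.le hd.le,
      Real.rpow_sub_one ha.ne', Real.rpow_sub_one hd.ne', ← Real.rpow_natCast x 2,
      ← Real.rpow_mul hx.le, ← Real.rpow_sub_one hx.ne']
    congr 2
    push_cast
    ring
  rw [e1, e2, Real.div_rpow (by positivity) hd.le, Real.rpow_add hd]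
  have hβ := (beta_pos hm hms).ne'
  have h1 : (a * x ^ 2 + d) ^ (m + ms) ≠ 0 := (Real.rpow_pos_of_pos (by positivity) _).ne'
  have h2 : d ^ m ≠ 0 := (Real.rpow_pos_of_pos hd _).ne'
  field_simp

/-- A moment of a beta prime variable is a beta integral with parameters `m + s` and `ms - s`. Their
sum is free of `s`, so `Γ(m + ms)` cancels against the normalisation. -/
lemma integral_fisherLaw_cpow {m ms Ωm Ωs : ℝ} (hm : 0 < m) (hms : 0 < ms) (hΩm : 0 < Ωm)
    (hΩs : 0 < Ωs) {s : ℂ} (hs1 : -m < s.re) (hs2 : s.re < ms) :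
    ∫ r, ((m * Ωs / (ms * Ωm) * r ^ 2 : ℝ) : ℂ) ^ s ∂fisherLaw m ms Ωm Ωs =
      Complex.Gamma (m + s) * Complex.Gamma (ms - s) / (Real.Gamma m * Real.Gamma ms : ℝ) := by
  set q := m * Ωs / (ms * Ωm) with hq
  have hq0 : 0 < q := by positivity
  set G : ℝ → ℂ := fun v => (v : ℂ) ^ (m + s - 1) / ((1 + v : ℝ) : ℂ) ^ ((m + s) + (ms - s))
    with hG
  have hβ : (0 : ℝ) < beta m ms := beta_pos hm hms
  rw [fisherLaw, integral_withDensity_eq_integral_toReal_smul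
    (measurable_fisherPDF m ms Ωm Ωs).ennreal_ofReal (by simp)]
  have h1 : ∀ x : ℝ, (ENNReal.ofReal (fisherPDF m ms Ωm Ωs x)).toReal • ((q * x ^ 2 : ℝ) : ℂ) ^ s =
      (Ioi (0 : ℝ)).indicator
        (fun x => (2 * x ^ ((2 : ℝ) - 1)) • ((q * (beta m ms)⁻¹) • G (q * x ^ (2 : ℝ)))) x := by
    intro x
    rw [ENNReal.toReal_ofReal (fisherPDF_nonneg hm hms hΩm hΩs x)]
    by_cases hx : 0 < x
    · rw [indicator_of_mem (by exact hx), fisherPDF_eq_of_pos hm hms hΩm hΩs hx, ← hq]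
      have hw : 0 < q * x ^ 2 := by positivity
      have e1 : x ^ (2 : ℝ) = x ^ 2 := by exact_mod_cast Real.rpow_natCast x 2
      have e2 : x ^ ((2 : ℝ) - 1) = x := by norm_num
      rw [e1, e2]
      generalize q * x ^ 2 = w at *
      have hw' : (w : ℂ) ≠ 0 := by exact_mod_cast hw.ne'
      simp only [hG, real_smul]
      rw [show (m : ℂ) + s - 1 = ((m - 1 : ℝ) : ℂ) + s by push_cast; ring, cpow_add _ _ hw',
        show (m : ℂ) + s + (ms - s) = ((m + ms : ℝ) : ℂ) by push_cast; ring,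
        ← ofReal_cpow hw.le, ← ofReal_cpow (by positivity)]
      push_cast
      ring
    · rw [indicator_of_notMem (by exact hx), fisherPDF, if_neg hx, zero_smul]
  simp_rw [h1]
  rw [integral_indicator measurableSet_Ioi,
    -- First the square is substituted, then the scale `q` is removed.
    integral_comp_rpow_Ioi_of_pos (g := fun u => (q * (beta m ms)⁻¹) • G (q * u)) two_pos,
    integral_smul, integral_comp_mul_left_Ioi G 0 hq0, mul_zero, hG,
    integral_Ioi_cpow_div_one_add_cpow,
    betaIntegral_eq_Gamma_mul_div _ _ (by simp; linarith) (by simp; linarith), smul_smul]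
  have hΓ : Real.Gamma (m + ms) ≠ 0 := (Real.Gamma_pos_of_pos (by positivity)).ne'
  rw [show (m : ℂ) + s + (ms - s) = ((m + ms : ℝ) : ℂ) by push_cast; ring, Complex.Gamma_ofReal,
    real_smul, beta]
  have hΓ1 : Real.Gamma m ≠ 0 := (Real.Gamma_pos_of_pos hm).ne'
  have hΓ2 : Real.Gamma ms ≠ 0 := (Real.Gamma_pos_of_pos hms).ne'
  have hq' : (q : ℂ) ≠ 0 := by exact_mod_cast hq0.ne'
  have h3 : (Real.Gamma (m + ms) : ℂ) ≠ 0 := by exact_mod_cast hΓ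
  have h4 : (Real.Gamma m : ℂ) ≠ 0 := by exact_mod_cast hΓ1
  have h5 : (Real.Gamma ms : ℂ) ≠ 0 := by exact_mod_cast hΓ2
  push_cast
  field_simp

/-! ### The unnormalised Erlang measure -/

/-- The measure with density `tⁱ e⁻ᵗ` on the positive half-line. -/
noncomputable def erlangMeasure (i : ℕ) : Measure ℝ :=
  (volume.restrict (Ioi 0)).withDensity fun t => ENNReal.ofReal (t ^ i * Real.exp (-t))

lemma integrableOn_pow_mul_exp_neg (i : ℕ) :
    IntegrableOn (fun t : ℝ => t ^ i * Real.exp (-t)) (Ioi 0) := by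
  have := Real.GammaIntegral_convergent (s := (i : ℝ) + 1) (by positivity)
  simpa [mul_comm] using this

instance (i : ℕ) : IsFiniteMeasure (erlangMeasure i) :=
  isFiniteMeasure_withDensity_ofReal (integrableOn_pow_mul_exp_neg i).2

instance (i : ℕ) : NullSingletonClass (erlangMeasure i) := by
  unfold erlangMeasure
  infer_instance

lemma ae_erlangMeasure_pos (i : ℕ) : ∀ᵐ t ∂erlangMeasure i, 0 < t :=
  (withDensity_absolutelyContinuous _ _).ae_le (ae_restrict_mem measurableSet_Ioi)

lemma integral_erlangMeasure {E : Type*} [NormedAddCommGroup E] [NormedSpace ℝ E] (i : ℕ)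
    (f : ℝ → E) :
    ∫ t, f t ∂erlangMeasure i = ∫ t in Ioi (0 : ℝ), (t ^ i * Real.exp (-t)) • f t := by
  rw [erlangMeasure, integral_withDensity_eq_integral_toReal_smul (by fun_prop) (by simp)]
  refine setIntegral_congr_fun measurableSet_Ioi fun t ht => ?_
  have ht' : (0 : ℝ) < t := ht
  rw [ENNReal.toReal_ofReal (by positivity)]

lemma integral_erlangMeasure_cpow (i : ℕ) {s : ℂ} (hs : -((i : ℝ) + 1) < s.re) :
    ∫ t, (t : ℂ) ^ s ∂erlangMeasure i = Complex.Gamma (1 + i + s) := by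
  rw [integral_erlangMeasure, Complex.Gamma_eq_integral (by simp; linarith), Complex.GammaIntegral]
  refine setIntegral_congr_fun measurableSet_Ioi fun t ht => ?_
  have ht' : (t : ℂ) ≠ 0 := by exact_mod_cast (ne_of_gt ht)
  rw [show (1 : ℂ) + i + s - 1 = i + s by ring, cpow_add _ _ ht', cpow_natCast, real_smul]
  push_cast
  ring

lemma measureReal_prod_eq_integral {α β : Type*} [MeasurableSpace α] [MeasurableSpace β]
    (μ : Measure α) (ν : Measure β) [IsFiniteMeasure μ] [IsFiniteMeasure ν] {s : Set (α × β)}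
    (hs : MeasurableSet s) : (μ.prod ν).real s = ∫ x, ν.real (Prod.mk x ⁻¹' s) ∂μ := by
  rw [measureReal_def, Measure.prod_apply hs]
  simp only [measureReal_def]
  rw [integral_toReal (measurable_measure_prodMk_left hs).aemeasurable
    (.of_forall fun x => measure_lt_top _ _)]

lemma measureReal_prod_eq_integral_symm {α β : Type*} [MeasurableSpace α] [MeasurableSpace β]
    (μ : Measure α) (ν : Measure β) [IsFiniteMeasure μ] [IsFiniteMeasure ν] {s : Set (α × β)}
    (hs : MeasurableSet s) : (μ.prod ν).real s = ∫ y, μ.real ((fun x => (x, y)) ⁻¹' s) ∂ν := by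
  rw [measureReal_def, Measure.prod_apply_symm hs]
  simp only [measureReal_def]
  rw [integral_toReal (measurable_measure_prodMk_right hs).aemeasurable
    (.of_forall fun x => measure_lt_top _ _)]

/-! ### The product of an Erlang variable and a squared Fisher–Snedecor variable -/

section Product

variable {m ms Ωm Ωs : ℝ}

/-- A Bochner integral takes the default value `0` on non-integrable functions, so a nonzero closed
form already certifies integrability. -/
lemma integrable_rpow_of_integral_cpow_ne_zero {α : Type*} [MeasurableSpace α] {μ : Measure α}
    {Y : α → ℝ} (hpos : ∀ᵐ a ∂μ, 0 < Y a) {c : ℝ} (h : ∫ a, (Y a : ℂ) ^ (c : ℂ) ∂μ ≠ 0) :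
    Integrable (fun a => Y a ^ c) μ := by
  refine (Integrable.of_integral_ne_zero h).re.congr ?_
  filter_upwards [hpos] with a ha
  rw [← ofReal_cpow ha.le]
  simp

/-- The product `t w`, where `w = (m Ωs / (ms Ωm)) r²` is the normalised squared envelope. -/
noncomputable def erlangFisherProduct (m ms Ωm Ωs : ℝ) (p : ℝ × ℝ) : ℝ :=
  m * Ωs / (ms * Ωm) * p.1 ^ 2 * p.2

lemma measurable_erlangFisherProduct : Measurable (erlangFisherProduct m ms Ωm Ωs) := by
  unfold erlangFisherProduct
  fun_prop

lemma ae_pos_and_pos (i : ℕ) :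
    ∀ᵐ p ∂(fisherLaw m ms Ωm Ωs).prod (erlangMeasure i), 0 < p.1 ∧ 0 < p.2 :=
  (Measure.quasiMeasurePreserving_fst.ae (ae_fisherLaw_pos m ms Ωm Ωs)).and
    (Measure.quasiMeasurePreserving_snd.ae (ae_erlangMeasure_pos i))

lemma ae_erlangFisherProduct_pos (hm : 0 < m) (hms : 0 < ms) (hΩm : 0 < Ωm) (hΩs : 0 < Ωs)
    (i : ℕ) :
    ∀ᵐ p ∂(fisherLaw m ms Ωm Ωs).prod (erlangMeasure i),
      0 < erlangFisherProduct m ms Ωm Ωs p := by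
  filter_upwards [ae_pos_and_pos i] with p hp
  have h1 := hp.1
  have h2 := hp.2
  unfold erlangFisherProduct
  positivity

variable [IsFiniteMeasure (fisherLaw m ms Ωm Ωs)]

lemma integral_erlangFisherProduct_cpow (hm : 0 < m) (hms : 0 < ms) (hΩm : 0 < Ωm) (hΩs : 0 < Ωs)
    (i : ℕ) {s : ℂ} (hs1 : -m < s.re) (hs2 : s.re < ms)
    (hs3 : -((i : ℝ) + 1) < s.re) :
    ∫ p, (erlangFisherProduct m ms Ωm Ωs p : ℂ) ^ s
        ∂(fisherLaw m ms Ωm Ωs).prod (erlangMeasure i) =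
      Complex.Gamma (m + s) * Complex.Gamma (ms - s) / (Real.Gamma m * Real.Gamma ms : ℝ)
        * Complex.Gamma (1 + i + s) := by
  rw [← integral_fisherLaw_cpow hm hms hΩm hΩs hs1 hs2, ← integral_erlangMeasure_cpow i hs3,
    ← integral_prod_mul]
  refine integral_congr_ae ?_
  filter_upwards [ae_pos_and_pos i] with p hp
  rw [erlangFisherProduct, ofReal_mul, mul_cpow_ofReal_nonneg (by positivity) hp.2.le]

lemma hasMellin_erlangFisherProduct (hm : 0 < m) (hms : 0 < ms) (hΩm : 0 < Ωm) (hΩs : 0 < Ωs)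
    (i : ℕ) {s : ℂ} (hs1 : -m < s.re) (hs2 : s.re < 0)
    (hs3 : -((i : ℝ) + 1) < s.re) :
    HasMellin (fun x => (((fisherLaw m ms Ωm Ωs).prod (erlangMeasure i)).real
        {p | erlangFisherProduct m ms Ωm Ωs p ≤ x} : ℂ)) s
      (-(1 / s) * (Complex.Gamma (m + s) * Complex.Gamma (ms - s)
        / (Real.Gamma m * Real.Gamma ms : ℝ) * Complex.Gamma (1 + i + s))) := by
  rw [← integral_erlangFisherProduct_cpow hm hms hΩm hΩs i hs1 (by linarith) hs3]
  refine hasMellin_measureReal_le _ measurable_erlangFisherProduct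
    (ae_erlangFisherProduct_pos hm hms hΩm hΩs i) hs2 ?_
  -- At the real exponent `Re s` the moment is a product of gamma values with positive real parts,
  -- hence nonzero.
  refine integrable_rpow_of_integral_cpow_ne_zero
    (ae_erlangFisherProduct_pos hm hms hΩm hΩs i) ?_
  rw [integral_erlangFisherProduct_cpow hm hms hΩm hΩs i (by simpa using hs1)
    (by simp; linarith) (by simpa using hs3)]
  have h1 : (Real.Gamma m * Real.Gamma ms : ℝ) ≠ 0 :=
    mul_ne_zero (Real.Gamma_pos_of_pos hm).ne' (Real.Gamma_pos_of_pos hms).ne'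
  refine mul_ne_zero (div_ne_zero (mul_ne_zero ?_ ?_) (by exact_mod_cast h1)) ?_
  all_goals
    refine Complex.Gamma_ne_zero_of_re_pos ?_
    simp
    linarith

/-- For each fixed `r > 0` only one `t` gives the product the value `x`, and the Erlang measure has
no atoms. -/
lemma continuousAt_erlangFisherProduct (hm : 0 < m) (hms : 0 < ms) (hΩm : 0 < Ωm) (hΩs : 0 < Ωs)
    (i : ℕ) (x : ℝ) :
    ContinuousAt (fun x => ((fisherLaw m ms Ωm Ωs).prod (erlangMeasure i)).real
      {p | erlangFisherProduct m ms Ωm Ωs p ≤ x}) x := by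
  refine continuousAt_measureReal_le _ measurable_erlangFisherProduct ?_
  rw [ae_iff]
  simp only [ne_eq, not_not]
  have hset : MeasurableSet {p | erlangFisherProduct m ms Ωm Ωs p = x} :=
    measurable_erlangFisherProduct (measurableSet_singleton x)
  rw [Measure.measure_prod_null hset]
  filter_upwards [ae_fisherLaw_pos m ms Ωm Ωs] with r hr
  refine measure_mono_null (t := {x / (m * Ωs / (ms * Ωm) * r ^ 2)}) ?_ (measure_singleton _)
  intro t ht
  have h : m * Ωs / (ms * Ωm) * r ^ 2 * t = x := ht
  rw [mem_singleton_iff, eq_div_iff (by positivity), mul_comm]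
  exact h

end Product

end Relay

namespace Relay

open Complex Set

/-! ### The Mellin–Barnes integral -/

/-- Only the nearest pole of each family (`l = 0`) matters; the lower parameter `0` forces `c < 0`,
which absorbs `c < ms`. -/
lemma separates_iff {m ms : ℝ} (hms : 0 < ms) (i : ℕ) (c : ℝ) :
    Separates 2 2 (upperParams m i) (lowerParams ms) c ↔
      -((i : ℝ) + 1) < c ∧ -m < c ∧ c < 0 := by
  simp only [Separates, upperParams, lowerParams, Fin.forall_fin_succ]
  simp
  constructor
  · rintro ⟨⟨h1, h2⟩, -, h4⟩
    have a1 := h1 0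
    have a2 := h2 0
    have a4 := h4 0
    simp at a1 a2 a4
    exact ⟨by linarith, by linarith, a4⟩
  · rintro ⟨h1, h2, h3⟩
    refine ⟨⟨fun l => ?_, fun l => ?_⟩, fun l => ?_, fun l => ?_⟩ <;>
    · have : (0 : ℝ) ≤ l := l.cast_nonneg
      linarith

lemma exists_separates {m ms : ℝ} (hm : 0 < m) (hms : 0 < ms) (i : ℕ) :
    ∃ c, Separates 2 2 (upperParams m i) (lowerParams ms) c := by
  obtain ⟨c, h1, h2⟩ := exists_between (show max (-((i : ℝ) + 1)) (-m) < 0 from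
    max_lt (by have : (0 : ℝ) ≤ i := i.cast_nonneg
               linarith) (by linarith))
  exact ⟨c, (separates_iff hms i c).2 ⟨(max_lt_iff.1 h1).1, (max_lt_iff.1 h1).2, h2⟩⟩

/-- `Γ(-s)/Γ(1-s) = -1/s`: the parameter pair `1`, `0` encodes the passage from moments to a
distribution function. -/
lemma meijerIntegrand_eq (m ms : ℝ) (i : ℕ) (z : ℂ) {s : ℂ} (hs : s.re < 0) :
    meijerIntegrand 2 2 (upperParams m i) (lowerParams ms) z s =
      Complex.Gamma (ms - s) * (-(1 / s)) * Complex.Gamma (1 + i + s) * Complex.Gamma (m + s)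
        * z ^ s := by
  have hs0 : -s ≠ 0 := by intro h; simp at h; simp [h] at hs
  have hΓ : Complex.Gamma (-s) ≠ 0 := Complex.Gamma_ne_zero_of_re_pos (by simpa using hs)
  have h1 : Complex.Gamma (1 - s) = -s * Complex.Gamma (-s) := by
    rw [← Complex.Gamma_add_one _ hs0]; congr 1; ring
  have e1 : (Finset.univ.filter fun j : Fin 2 => j.val < 2) = {0, 1} := by decide
  have e2 : (Finset.univ.filter fun j : Fin 3 => j.val < 2) = {0, 1} := by decide
  have e3 : (Finset.univ.filter fun j : Fin 2 => 2 ≤ j.val) = ∅ := by decide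
  have e4 : (Finset.univ.filter fun j : Fin 3 => 2 ≤ j.val) = {2} := by decide
  rw [meijerIntegrand, e1, e2, e3, e4, Finset.prod_pair (by decide), Finset.prod_pair (by decide),
    Finset.prod_empty, Finset.prod_singleton]
  simp only [upperParams, lowerParams, Matrix.cons_val_zero, Matrix.cons_val_one, Matrix.cons_val,
    sub_neg_eq_add, sub_sub_cancel, one_mul, zero_sub, h1]
  have : s ≠ 0 := by simpa using hs0
  field_simp

lemma sq_mul_one_add_sq_le_norm_mul_norm {e y : ℝ} (he0 : 0 ≤ e) (he1 : e ≤ 1) {z w : ℂ}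
    (hz : e ≤ |z.re|) (hw : e ≤ |w.re|) (hzy : z.im = y) (hwy : w.im = y) :
    e ^ 2 * (1 + y ^ 2) ≤ ‖z‖ * ‖w‖ := by
  have key : ∀ u : ℂ, e ≤ |u.re| → u.im = y → e * √(1 + y ^ 2) ≤ ‖u‖ := by
    intro u hu huy
    rw [Complex.norm_eq_sqrt_sq_add_sq, huy]
    refine Real.le_sqrt_of_sq_le ?_
    rw [mul_pow, Real.sq_sqrt (by positivity)]
    have h1 : e ^ 2 ≤ u.re ^ 2 := by rw [← sq_abs u.re]; gcongr
    have h2 : e ^ 2 ≤ 1 := pow_le_one₀ he0 he1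
    nlinarith [sq_nonneg y]
  calc e ^ 2 * (1 + y ^ 2) = (e * √(1 + y ^ 2)) * (e * √(1 + y ^ 2)) := by
        rw [mul_mul_mul_comm, Real.mul_self_sqrt (by positivity)]; ring
    _ ≤ ‖z‖ * ‖w‖ := mul_le_mul (key z hz hzy) (key w hw hwy) (by positivity) (norm_nonneg _)

lemma continuousAt_Gamma_of_re_pos {s : ℂ} (hs : 0 < s.re) : ContinuousAt Complex.Gamma s := by
  refine (Complex.differentiableAt_Gamma s fun n h => ?_).continuousAt
  have : (0 : ℝ) ≤ n := n.cast_nonneg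
  rw [h] at hs
  simp at hs
  linarith

lemma integrable_Gamma_prod_mul_inv {m ms c : ℝ} (i : ℕ) (h1 : -((i : ℝ) + 1) < c)
    (h2 : -m < c) (h3 : c < 0) (h4 : c < ms) :
    Integrable fun y : ℝ => Complex.Gamma (ms - (c + y * I)) * (-(1 / ((c : ℂ) + y * I)))
      * Complex.Gamma (1 + i + (c + y * I)) * Complex.Gamma (m + (c + y * I)) := by
  have hre : ∀ y : ℝ, ((c : ℂ) + y * I).re = c := fun y => by simp
  have him : ∀ y : ℝ, ((c : ℂ) + y * I).im = y := fun y => by simp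
  have r1 : ∀ y : ℝ, ((ms : ℂ) - (c + y * I)).re = ms - c := fun y => by simp
  have r2 : ∀ y : ℝ, ((1 : ℂ) + i + (c + y * I)).re = 1 + i + c := fun y => by simp
  have r3 : ∀ y : ℝ, ((m : ℂ) + (c + y * I)).re = m + c := fun y => by simp
  have p1 : 0 < ms - c := by linarith
  have p2 : 0 < 1 + i + c := by linarith
  have p3 : 0 < m + c := by linarith
  have hne : ∀ y : ℝ, (c : ℂ) + y * I ≠ 0 := fun y h => by
    have := hre y
    rw [h] at this
    simp at this
    linarith
  -- A common lower bound for the distances of the line from the poles at `0` and `-(i+1)`, capped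
  -- at `1` as the norm estimate requires.
  set e : ℝ := min 1 (min (-c) (1 + i + c)) with he
  have he0 : 0 < e := lt_min one_pos (lt_min (by linarith) p2)
  set K : ℝ := Real.Gamma (ms - c) * Real.Gamma (1 + i + c + 1) * Real.Gamma (m + c) with hK
  have k1 := Real.Gamma_pos_of_pos p1
  have k2 := Real.Gamma_pos_of_pos (show 0 < 1 + i + c + 1 by linarith)
  have k3 := Real.Gamma_pos_of_pos p3
  refine (integrable_inv_one_add_sq.const_mul (K / e ^ 2)).mono' ?_ ?_
  · refine Continuous.aestronglyMeasurable (continuous_iff_continuousAt.2 fun y => ?_)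
    have hl : ContinuousAt (fun y : ℝ => (c : ℂ) + y * I) y := by fun_prop
    refine ((ContinuousAt.mul ?_ ?_).mul ?_).mul ?_
    · exact (continuousAt_Gamma_of_re_pos (by rw [r1]; exact p1)).comp (continuousAt_const.sub hl)
    · exact (continuousAt_const.div hl (hne y)).neg
    · exact (continuousAt_Gamma_of_re_pos (by rw [r2]; exact p2)).comp (continuousAt_const.add hl)
    · exact (continuousAt_Gamma_of_re_pos (by rw [r3]; exact p3)).comp (continuousAt_const.add hl)
  · refine .of_forall fun y => ?_
    have b1 := norm_Gamma_le_Gamma_re (z := (ms : ℂ) - (c + y * I)) (by rw [r1]; exact p1)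
    have b2 := norm_Gamma_le_Gamma_re_add_one_div (z := (1 : ℂ) + i + (c + y * I))
      (by rw [r2]; exact p2)
    have b3 := norm_Gamma_le_Gamma_re (z := (m : ℂ) + (c + y * I)) (by rw [r3]; exact p3)
    rw [r1] at b1
    rw [r2] at b2
    rw [r3] at b3
    have b4 := sq_mul_one_add_sq_le_norm_mul_norm (e := e) (y := y) he0.le (min_le_left _ _)
      (z := (c : ℂ) + y * I) (w := (1 : ℂ) + i + (c + y * I))
      (by rw [hre, abs_of_neg h3]; exact (min_le_right _ _).trans (min_le_left _ _))
      (by rw [r2, abs_of_pos p2]; exact (min_le_right _ _).trans (min_le_right _ _))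
      (him y) (by simp)
    rw [norm_mul, norm_mul, norm_mul, norm_neg, norm_div, norm_one]
    calc _ ≤ Real.Gamma (ms - c) * (1 / ‖(c : ℂ) + y * I‖)
          * (Real.Gamma (1 + i + c + 1) / ‖(1 : ℂ) + i + (c + y * I)‖) * Real.Gamma (m + c) := by
          gcongr
      _ = K / (‖(c : ℂ) + y * I‖ * ‖(1 : ℂ) + i + (c + y * I)‖) := by
          rw [hK]
          simp only [div_eq_mul_inv, mul_inv]
          ring
      _ ≤ K / (e ^ 2 * (1 + y ^ 2)) := by
          gcongr
      _ = K / e ^ 2 * (1 + y ^ 2)⁻¹ := by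
          rw [div_mul_eq_div_div, div_eq_mul_inv (K / e ^ 2)]

section MellinBarnes

variable {m ms Ωm Ωs : ℝ} [IsFiniteMeasure (fisherLaw m ms Ωm Ωs)]

lemma integrable_meijerIntegrand (hms : 0 < ms) {z : ℝ} (hz : 0 < z) (i : ℕ) {c : ℝ}
    (hc : Separates 2 2 (upperParams m i) (lowerParams ms) c) :
    Integrable fun y : ℝ => meijerIntegrand 2 2 (upperParams m i) (lowerParams ms) z
      ((c : ℂ) + y * I) := by
  obtain ⟨h1, h2, h3⟩ := (separates_iff hms i c).1 hc
  have hz' : (z : ℂ) ≠ 0 := by exact_mod_cast hz.ne'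
  have heq : (fun y : ℝ => meijerIntegrand 2 2 (upperParams m i) (lowerParams ms) (z : ℂ)
      ((c : ℂ) + y * I)) = fun y : ℝ => (Complex.Gamma (ms - (c + y * I))
        * (-(1 / ((c : ℂ) + y * I))) * Complex.Gamma (1 + i + (c + y * I))
          * Complex.Gamma (m + (c + y * I))) * (z : ℂ) ^ ((c : ℂ) + y * I) :=
    funext fun y => meijerIntegrand_eq m ms i z (by simpa using h3)
  rw [heq]
  refine (integrable_Gamma_prod_mul_inv i h1 h2 h3 (by linarith)).mul_bdd (c := z ^ c) ?_ ?_
  · refine Continuous.aestronglyMeasurable ?_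
    exact Continuous.const_cpow (by fun_prop) (.inl hz')
  · refine .of_forall fun y => ?_
    rw [norm_cpow_eq_rpow_re_of_pos hz]
    simp

/-- Along every separating line, the Mellin–Barnes integral is the distribution function of the
product of an Erlang variable and a normalised squared Fisher–Snedecor variable. -/
lemma meijerLine_eq (hm : 0 < m) (hms : 0 < ms) (hΩm : 0 < Ωm) (hΩs : 0 < Ωs)
    {z : ℝ} (hz : 0 < z) (i : ℕ) {c : ℝ}
    (hc : Separates 2 2 (upperParams m i) (lowerParams ms) c) :
    meijerLine 2 2 (upperParams m i) (lowerParams ms) z c =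
      (Real.Gamma m * Real.Gamma ms * ((fisherLaw m ms Ωm Ωs).prod (erlangMeasure i)).real
        {p | erlangFisherProduct m ms Ωm Ωs p ≤ z⁻¹} : ℝ) := by
  obtain ⟨h1, h2, h3⟩ := (separates_iff hms i c).1 hc
  have hΓ : ((Real.Gamma m * Real.Gamma ms : ℝ) : ℂ) ≠ 0 := by
    exact_mod_cast mul_ne_zero (Real.Gamma_pos_of_pos hm).ne' (Real.Gamma_pos_of_pos hms).ne'
  set f : ℝ → ℂ := fun x => (((fisherLaw m ms Ωm Ωs).prod (erlangMeasure i)).real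
    {p | erlangFisherProduct m ms Ωm Ωs p ≤ x} : ℂ) with hf
  have hM : ∀ y : ℝ, HasMellin f ((c : ℂ) + y * I) _ := fun y =>
    hasMellin_erlangFisherProduct hm hms hΩm hΩs i (by simpa using h2) (by simpa using h3)
      (by simpa using h1)
  have hMy : ∀ y : ℝ, mellin f ((c : ℂ) + y * I) =
      (Complex.Gamma (ms - (c + y * I)) * (-(1 / ((c : ℂ) + y * I)))
        * Complex.Gamma (1 + i + (c + y * I)) * Complex.Gamma (m + (c + y * I)))
          / (Real.Gamma m * Real.Gamma ms : ℝ) := fun y => by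
    rw [(hM y).2]
    ring
  have hconv : MellinConvergent f (c : ℂ) := by simpa using (hM 0).1
  have hvert : VerticalIntegrable (mellin f) c := by
    unfold VerticalIntegrable
    simp only [hMy]
    exact (integrable_Gamma_prod_mul_inv i h1 h2 h3 (by linarith)).div_const _
  have hcont : ContinuousAt f z⁻¹ := continuous_ofReal.continuousAt.comp
    (continuousAt_erlangFisherProduct hm hms hΩm hΩs i z⁻¹)
  -- The inversion kernel is `x^(-s)`, so the integrand's `zˢ` calls for the point `x = z⁻¹`.
  have hinv := mellinInv_mellin_eq c f (inv_pos.2 hz) hconv hvert hcont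
  rw [ofReal_mul]
  change _ = _ * f z⁻¹
  rw [← hinv, mellinInv, meijerLine, real_smul, mul_left_comm]
  rw [show ((1 / (2 * Real.pi) : ℝ) : ℂ) = 1 / (2 * (Real.pi : ℂ)) by push_cast; rfl,
    ← integral_const_mul (Complex.ofReal _)]
  congr 1
  refine integral_congr_ae (.of_forall fun y => ?_)
  simp only
  rw [meijerIntegrand_eq m ms i z (by simpa using h3), hMy, smul_eq_mul, ofReal_inv,
    inv_cpow _ _ (by rw [arg_ofReal_of_nonneg hz.le]; exact Real.pi_pos.ne), cpow_neg, inv_inv]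
  rw [mul_left_comm, mul_div_cancel₀ _ hΓ, mul_comm]

lemma meijerG_eq (hm : 0 < m) (hms : 0 < ms) (hΩm : 0 < Ωm) (hΩs : 0 < Ωs)
    {z : ℝ} (hz : 0 < z) (i : ℕ) :
    meijerG 2 2 (upperParams m i) (lowerParams ms) z =
      (Real.Gamma m * Real.Gamma ms * ((fisherLaw m ms Ωm Ωs).prod (erlangMeasure i)).real
        {p | erlangFisherProduct m ms Ωm Ωs p ≤ z⁻¹} : ℝ) := by
  have h := exists_separates hm hms i
  rw [meijerG, dif_pos h]
  exact meijerLine_eq hm hms hΩm hΩs hz i h.choose_spec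

lemma meijerGWellDefined (hm : 0 < m) (hms : 0 < ms) (hΩm : 0 < Ωm) (hΩs : 0 < Ωs)
    {z : ℝ} (hz : 0 < z) (i : ℕ) :
    MeijerGWellDefined 2 2 (upperParams m i) (lowerParams ms) z :=
  ⟨exists_separates hm hms i, fun _ hc => ⟨integrable_meijerIntegrand hms hz i hc, by
    rw [meijerLine_eq hm hms hΩm hΩs hz i hc, meijerG_eq hm hms hΩm hΩs hz i]⟩⟩

end MellinBarnes

end Relay

namespace Relay

open Set

/-! ### The shadowed-Rician law -/

section ShadowedRician

variable {b Ωsr : ℝ} {Γs : ℕ}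

lemma betaSR_sub_deltaSR_pos (hb : 0 < b) (hΓs : 1 ≤ Γs) (hΩsr : 0 ≤ Ωsr) :
    0 < betaSR b - deltaSR b Γs Ωsr := by
  have h : (0 : ℝ) < Γs := by exact_mod_cast hΓs
  have e : betaSR b - deltaSR b Γs Ωsr = Γs / (2 * b * Γs + Ωsr) := by
    unfold betaSR deltaSR
    field_simp
    ring
  rw [e]
  positivity

lemma alphaSR_nonneg (hb : 0 < b) (hΩsr : 0 ≤ Ωsr) : 0 ≤ alphaSR b Γs Ωsr := by
  unfold alphaSR
  positivity

/-- The sign `(-1)ᵏ` cancels that of `(1 - Γs)ₖ`, leaving the coefficients of Kummer's polynomial,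
which are visibly nonnegative. -/
lemma coeffC_eq (hΓs : 1 ≤ Γs) (k : ℕ) :
    coeffC b Γs Ωsr k = ((Γs - 1).choose k : ℝ) / k.factorial * deltaSR b Γs Ωsr ^ k := by
  have h : (1 : ℝ) - Γs = -((Γs - 1 : ℕ) : ℝ) := by push_cast [hΓs]; ring
  rw [coeffC, h, neg_one_pow_mul_ascPochhammer_eval_neg]
  have : (k.factorial : ℝ) ≠ 0 := by exact_mod_cast k.factorial_ne_zero
  field_simp

lemma coeffC_nonneg (hb : 0 < b) (hΓs : 1 ≤ Γs) (hΩsr : 0 ≤ Ωsr) (k : ℕ) :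
    0 ≤ coeffC b Γs Ωsr k := by
  rw [coeffC_eq hΓs]
  unfold deltaSR
  positivity

/-- The closed form `α e^(-κ x) ∑ₖ cₖ xᵏ` of the shadowed-Rician density, `κ = β - δ`. -/
noncomputable def shadowedRicianDensity (b : ℝ) (Γs : ℕ) (Ωsr x : ℝ) : ℝ :=
  alphaSR b Γs Ωsr * (Real.exp (-((betaSR b - deltaSR b Γs Ωsr) * x))
    * ∑ k ∈ Finset.range Γs, coeffC b Γs Ωsr k * x ^ k)

lemma shadowedRicianPDF_of_pos (hΓs : 1 ≤ Γs) {x : ℝ} (hx : 0 < x) :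
    shadowedRicianPDF b Γs Ωsr x = shadowedRicianDensity b Γs Ωsr x := by
  have h : (Γs : ℝ) = ((Γs - 1 : ℕ) : ℝ) + 1 := by push_cast [hΓs]; ring
  have hk : kummer (Γs : ℝ) 1 (deltaSR b Γs Ωsr * x) = Real.exp (deltaSR b Γs Ωsr * x)
      * ∑ k ∈ Finset.range Γs, coeffC b Γs Ωsr k * x ^ k := by
    conv_lhs => rw [h, kummer_natCast_add_one, ← h, Nat.sub_add_cancel hΓs]
    congr 1
    refine Finset.sum_congr rfl fun k _ => ?_
    rw [coeffC_eq hΓs, mul_pow]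
    ring
  have he : Real.exp (-((betaSR b - deltaSR b Γs Ωsr) * x)) =
      Real.exp (-betaSR b * x) * Real.exp (deltaSR b Γs Ωsr * x) := by
    rw [← Real.exp_add]
    congr 1
    ring
  rw [shadowedRicianPDF, if_pos hx, hk, shadowedRicianDensity, he]
  ring

lemma shadowedRicianDensity_nonneg (hb : 0 < b) (hΓs : 1 ≤ Γs) (hΩsr : 0 ≤ Ωsr) {x : ℝ}
    (hx : 0 < x) : 0 ≤ shadowedRicianDensity b Γs Ωsr x :=
  mul_nonneg (alphaSR_nonneg hb hΩsr) (mul_nonneg (Real.exp_pos _).le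
    (Finset.sum_nonneg fun k _ => mul_nonneg (coeffC_nonneg hb hΓs hΩsr k) (pow_nonneg hx.le k)))

lemma measurable_shadowedRicianDensity : Measurable (shadowedRicianDensity b Γs Ωsr) := by
  unfold shadowedRicianDensity
  fun_prop

lemma shadowedRicianLaw_eq (hΓs : 1 ≤ Γs) :
    shadowedRicianLaw b Γs Ωsr = (volume.restrict (Ioi 0)).withDensity
      fun x => ENNReal.ofReal (shadowedRicianDensity b Γs Ωsr x) := by
  rw [shadowedRicianLaw, ← withDensity_indicator measurableSet_Ioi]
  congr 1
  ext x
  by_cases hx : 0 < x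
  · rw [indicator_of_mem (by exact hx), shadowedRicianPDF_of_pos hΓs hx]
  · rw [indicator_of_notMem (by exact hx), shadowedRicianPDF, if_neg hx, ENNReal.ofReal_zero]

lemma setIntegral_shadowedRicianLaw (hb : 0 < b) (hΓs : 1 ≤ Γs) (hΩsr : 0 ≤ Ωsr) {s : Set ℝ}
    (hs : MeasurableSet s) (f : ℝ → ℝ) :
    ∫ x in s, f x ∂shadowedRicianLaw b Γs Ωsr =
      ∫ x in s ∩ Ioi 0, shadowedRicianDensity b Γs Ωsr x * f x := by
  rw [shadowedRicianLaw_eq hΓs, restrict_withDensity hs,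
    integral_withDensity_eq_integral_toReal_smul
      measurable_shadowedRicianDensity.ennreal_ofReal (by simp), Measure.restrict_restrict hs]
  refine setIntegral_congr_fun (hs.inter measurableSet_Ioi) fun x hx => ?_
  simp only [smul_eq_mul]
  rw [ENNReal.toReal_ofReal (shadowedRicianDensity_nonneg hb hΓs hΩsr hx.2)]

lemma integral_pow_mul_exp_neg_mul {κ : ℝ} (hκ : 0 < κ) (k : ℕ) (g : ℝ) :
    ∫ x in (0 : ℝ)..g, x ^ k * Real.exp (-(κ * x)) =
      lowerGamma ((k : ℝ) + 1) (κ * g) / κ ^ (k + 1) := by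
  have h := intervalIntegral.integral_comp_mul_left (a := 0) (b := g)
    (fun t : ℝ => t ^ ((k : ℝ) + 1 - 1) * Real.exp (-t)) hκ.ne'
  rw [mul_zero, ← lowerGamma] at h
  simp only [add_sub_cancel_right, Real.rpow_natCast, mul_pow, mul_assoc] at h
  rw [intervalIntegral.integral_const_mul, smul_eq_mul] at h
  rw [pow_succ, eq_div_iff (by positivity)]
  field_simp at h
  linarith

/-- The distribution function of the shadowed-Rician law. -/
lemma measureReal_shadowedRicianLaw_Iic (hb : 0 < b) (hΓs : 1 ≤ Γs) (hΩsr : 0 ≤ Ωsr) {g : ℝ}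
    (hg : 0 ≤ g) :
    (shadowedRicianLaw b Γs Ωsr).real (Iic g) =
      alphaSR b Γs Ωsr * ∑ k ∈ Finset.range Γs,
        coeffC b Γs Ωsr k / (betaSR b - deltaSR b Γs Ωsr) ^ (k + 1)
          * lowerGamma ((k : ℝ) + 1) ((betaSR b - deltaSR b Γs Ωsr) * g) := by
  have hκ := betaSR_sub_deltaSR_pos hb hΓs hΩsr
  have h := setIntegral_shadowedRicianLaw hb hΓs hΩsr (measurableSet_Iic (a := g)) fun _ => 1
  rw [setIntegral_const, smul_eq_mul, mul_one, inter_comm, Ioi_inter_Iic] at h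
  simp only [mul_one, shadowedRicianDensity] at h
  rw [h, integral_const_mul, ← intervalIntegral.integral_of_le hg]
  congr 1
  simp only [Finset.mul_sum]
  rw [intervalIntegral.integral_finsetSum fun k _ =>
    Continuous.intervalIntegrable (by fun_prop) _ _]
  refine Finset.sum_congr rfl fun k _ => ?_
  rw [div_mul_eq_mul_div, mul_div_assoc, ← integral_pow_mul_exp_neg_mul hκ,
    ← intervalIntegral.integral_const_mul]
  congr 1
  ext x
  ring

end ShadowedRician

/-! ### Splitting off the contribution of strong first links -/

lemma setIntegral_Ioi_comp_mul_sub (F : ℝ → ℝ) {κ : ℝ} (hκ : 0 < κ) (g : ℝ) :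
    ∫ x in Ioi g, F x = κ⁻¹ * ∫ u in Ioi (0 : ℝ), F (g + u / κ) := by
  have h1 : ∫ x in Ioi g, F x = ∫ t in Ioi (0 : ℝ), F (g + t) := by
    have := (measurePreserving_add_left volume g).setIntegral_preimage_emb
      (measurableEmbedding_addLeft g) F (Ioi g)
    rw [← this]
    simp
  have h2 := integral_comp_mul_left_Ioi (fun t => F (g + t)) 0 (inv_pos.2 hκ)
  rw [mul_zero, inv_inv, smul_eq_mul] at h2
  rw [h1]
  simp only [div_eq_inv_mul]
  rw [h2, inv_mul_cancel_left₀ hκ.ne']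

/-- The substitution `x = g + u/κ` pulls out `e^(-κg)`, and the binomial theorem leaves the weights
`uⁱ e⁻ᵘ`. In `κ^(i+1)`, `i` factors come from `(u/κ)ⁱ` and one from the Jacobian. -/
lemma setIntegral_Ioi_exp_mul_poly_mul (c : ℕ → ℝ) (n : ℕ) {κ : ℝ} (hκ : 0 < κ) (g : ℝ)
    {ψ φ : ℝ → ℝ} (hψ : Measurable ψ) {M : ℝ} (hM : ∀ u, ‖ψ u‖ ≤ M)
    (hφ : ∀ u, 0 < u → φ (g + u / κ) = ψ u) :
    ∫ x in Ioi g, Real.exp (-(κ * x)) * (∑ k ∈ Finset.range n, c k * x ^ k) * φ x =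
      Real.exp (-(κ * g)) * ∑ k ∈ Finset.range n, c k * ∑ i ∈ Finset.range (k + 1),
        (k.choose i : ℝ) * (κ ^ (i + 1))⁻¹ * g ^ (k - i) * ∫ u, ψ u ∂erlangMeasure i := by
  have hint : ∀ i : ℕ, Integrable (fun u : ℝ => u ^ i * Real.exp (-u) * ψ u)
      (volume.restrict (Ioi 0)) := fun i =>
    (integrableOn_pow_mul_exp_neg i).mul_bdd hψ.aestronglyMeasurable (.of_forall hM)
  have hpt : ∀ u ∈ Ioi (0 : ℝ), Real.exp (-(κ * (g + u / κ)))
      * (∑ k ∈ Finset.range n, c k * (g + u / κ) ^ k) * φ (g + u / κ) =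
      ∑ k ∈ Finset.range n, ∑ i ∈ Finset.range (k + 1),
        (Real.exp (-(κ * g)) * c k * ((k.choose i : ℝ) * (κ ^ i)⁻¹ * g ^ (k - i)))
          * (u ^ i * Real.exp (-u) * ψ u) := by
    intro u hu
    have he : Real.exp (-(κ * (g + u / κ))) = Real.exp (-(κ * g)) * Real.exp (-u) := by
      rw [← Real.exp_add]
      congr 1
      field_simp
      ring
    rw [hφ u hu, he, Finset.mul_sum, Finset.sum_mul]
    refine Finset.sum_congr rfl fun k _ => ?_
    rw [add_comm g, add_pow, Finset.mul_sum, Finset.mul_sum, Finset.sum_mul]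
    refine Finset.sum_congr rfl fun i _ => ?_
    rw [div_pow]
    ring
  rw [setIntegral_Ioi_comp_mul_sub _ hκ g, setIntegral_congr_fun measurableSet_Ioi hpt,
    integral_finsetSum _ fun k _ => integrable_finsetSum _ fun i _ => (hint i).const_mul _,
    Finset.mul_sum, Finset.mul_sum]
  refine Finset.sum_congr rfl fun k _ => ?_
  rw [integral_finsetSum _ fun i _ => (hint i).const_mul _, Finset.mul_sum, Finset.mul_sum,
    Finset.mul_sum]
  refine Finset.sum_congr rfl fun i _ => ?_
  rw [integral_const_mul, integral_erlangMeasure, pow_succ, mul_inv]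
  simp only [smul_eq_mul]
  ring

/-! ### The distribution function of the end-to-end signal-to-noise ratio -/

lemma snrAF_le_iff {C x y γ : ℝ} (hC : 0 < C) (hy : 0 ≤ y) :
    snrAF C x y ≤ γ ↔ (x - γ) * y ≤ γ * C := by
  rw [snrAF, div_le_iff₀ (by positivity)]
  constructor <;> intro h <;> linarith

lemma measureReal_prod_snrAF_le {b Ωsr γbarSR m ms Ωm Ωs γbarRU C γ : ℝ} {Γs : ℕ}
    (hb : 0 < b) (hΓs : 1 ≤ Γs) (hΩsr : 0 ≤ Ωsr) (hγbarSR : 0 < γbarSR)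
    (hm : 0 < m) (hms : 0 < ms) (hΩm : 0 < Ωm) (hΩs : 0 < Ωs) (hγbarRU : 0 < γbarRU)
    (hC : 0 < C) (hγ : 0 < γ) [IsProbabilityMeasure (shadowedRicianLaw b Γs Ωsr)]
    [IsProbabilityMeasure (fisherLaw m ms Ωm Ωs)] :
    ((shadowedRicianLaw b Γs Ωsr).prod (fisherLaw m ms Ωm Ωs)).real
        {p | snrAF C (γbarSR * p.1) (γbarRU * p.2 ^ 2) ≤ γ} =
      (shadowedRicianLaw b Γs Ωsr).real (Iic (γ / γbarSR)) +
        alphaSR b Γs Ωsr * (Real.exp (-((betaSR b - deltaSR b Γs Ωsr) * (γ / γbarSR)))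
          * ∑ k ∈ Finset.range Γs, coeffC b Γs Ωsr k * ∑ i ∈ Finset.range (k + 1),
            (k.choose i : ℝ) * ((betaSR b - deltaSR b Γs Ωsr) ^ (i + 1))⁻¹
              * (γ / γbarSR) ^ (k - i)
              * ((fisherLaw m ms Ωm Ωs).prod (erlangMeasure i)).real
                  {p | erlangFisherProduct m ms Ωm Ωs p ≤
                    (meijerArg b Γs Ωsr γbarSR m ms Ωm Ωs γbarRU C γ)⁻¹}) := by
  set S := shadowedRicianLaw b Γs Ωsr with hS
  set R := fisherLaw m ms Ωm Ωs with hR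
  set κ := betaSR b - deltaSR b Γs Ωsr with hκdef
  have hκ : 0 < κ := betaSR_sub_deltaSR_pos hb hΓs hΩsr
  set g := γ / γbarSR with hg
  have hg0 : 0 < g := by positivity
  set z := meijerArg b Γs Ωsr γbarSR m ms Ωm Ωs γbarRU C γ with hz
  have hsnr : Measurable fun p : ℝ × ℝ => snrAF C (γbarSR * p.1) (γbarRU * p.2 ^ 2) := by
    unfold snrAF
    fun_prop
  have hA : MeasurableSet {p : ℝ × ℝ | snrAF C (γbarSR * p.1) (γbarRU * p.2 ^ 2) ≤ γ} :=
    measurableSet_le hsnr measurable_const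
  have hB : MeasurableSet {p : ℝ × ℝ | erlangFisherProduct m ms Ωm Ωs p ≤ z⁻¹} :=
    measurableSet_le measurable_erlangFisherProduct measurable_const
  set φ : ℝ → ℝ := fun x => R.real
    (Prod.mk x ⁻¹' {p : ℝ × ℝ | snrAF C (γbarSR * p.1) (γbarRU * p.2 ^ 2) ≤ γ}) with hφ
  set ψ : ℝ → ℝ := fun u => R.real
    ((fun r => (r, u)) ⁻¹' {p : ℝ × ℝ | erlangFisherProduct m ms Ωm Ωs p ≤ z⁻¹}) with hψ
  have hφm : Measurable φ := (measurable_measure_prodMk_left hA).ennreal_toReal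
  have hψm : Measurable ψ := (measurable_measure_prodMk_right hB).ennreal_toReal
  have hbd : ∀ s : Set ℝ, ‖R.real s‖ ≤ 1 := fun s => by
    rw [Real.norm_of_nonneg measureReal_nonneg]
    exact measureReal_le_one
  have hφi : Integrable φ S := Integrable.of_bound hφm.aestronglyMeasurable 1
    (.of_forall fun x => hbd _)
  -- Here `γbarSR x - γ = γbarSR u/κ`, so the event depends on `u r²` alone, and the collected
  -- constants are those of `z⁻¹`.
  have hφψ : ∀ u, 0 < u → φ (g + u / κ) = ψ u := by
    intro u hu
    simp only [hφ, hψ]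
    congr 1
    ext r
    simp only [mem_preimage, mem_ofPred_eq]
    rw [snrAF_le_iff hC (by positivity), erlangFisherProduct, hz, meijerArg, ← hκdef, inv_div]
    have e1 : (γbarSR * (g + u / κ) - γ) * (γbarRU * r ^ 2) =
        (γbarSR * γbarRU / κ) * (u * r ^ 2) := by
      rw [hg]
      field_simp
      ring
    rw [e1]
    have e2 : m * Ωs / (ms * Ωm) * r ^ 2 * u = (m * Ωs / (ms * Ωm)) * (u * r ^ 2) := by ring
    have e3 : κ * m * Ωs * C * γ / (ms * Ωm * γbarSR * γbarRU) =
        (m * Ωs / (ms * Ωm)) * (γ * C / (γbarSR * γbarRU / κ)) := by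
      field_simp
    rw [e2, e3, mul_le_mul_iff_right₀ (by positivity), le_div_iff₀ (by positivity),
      mul_comm (u * r ^ 2)]
  rw [measureReal_prod_eq_integral _ _ hA]
  change ∫ x, φ x ∂S = _
  rw [← integral_add_compl (measurableSet_Iic (a := g)) hφi, compl_Iic]
  congr 1
  -- For `x ≤ g` the left side of `(γbarSR x - γ) y ≤ γ C` is nonpositive, so every `r` satisfies
  -- it.
  · have h1 : ∫ x in Iic g, φ x ∂S = ∫ x in Iic g, (1 : ℝ) ∂S := by
      refine setIntegral_congr_fun measurableSet_Iic fun x hx => ?_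
      have huniv : Prod.mk x ⁻¹' {p : ℝ × ℝ | snrAF C (γbarSR * p.1) (γbarRU * p.2 ^ 2) ≤ γ} =
          univ := by
        refine eq_univ_of_forall fun r => ?_
        simp only [mem_preimage, mem_ofPred_eq]
        rw [snrAF_le_iff hC (by positivity)]
        have h2 : γbarSR * x - γ ≤ 0 := by
          have := (le_div_iff₀ hγbarSR).1 (mem_Iic.1 hx)
          linarith
        exact (mul_nonpos_of_nonpos_of_nonneg h2 (by positivity)).trans (by positivity)
      simp only [hφ, huniv]
      simp
    rw [h1, setIntegral_const, smul_eq_mul, mul_one]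
  · rw [hS, setIntegral_shadowedRicianLaw hb hΓs hΩsr measurableSet_Ioi,
      inter_eq_left.2 (Ioi_subset_Ioi hg0.le)]
    simp only [shadowedRicianDensity, mul_assoc (alphaSR b Γs Ωsr)]
    rw [integral_const_mul, ← hκdef, setIntegral_Ioi_exp_mul_poly_mul (coeffC b Γs Ωsr) Γs hκ g hψm
      (fun u => hbd _) hφψ]
    simp only [measureReal_prod_eq_integral_symm _ _ hB, hψ]

end Relay

open Relay MeasureTheory ProbabilityTheory in
/-- Exact CDF of the end-to-end SNR of fixed-gain amplify-and-forward relaying over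
a shadowed-Rician first link and a Fisher–Snedecor `F` second link. -/
theorem mainTheorem1 {Ω : Type*} [MeasurableSpace Ω] (P : Measure Ω) [IsProbabilityMeasure P]
    (b Ωsr γbarSR m ms Ωm Ωs γbarRU C : ℝ) (Γs : ℕ)
    (hb : 0 < b) (hΓs : 1 ≤ Γs) (hΩsr : 0 ≤ Ωsr) (hγbarSR : 0 < γbarSR)
    (hm : 0 < m) (hms : 0 < ms) (hΩm : 0 < Ωm) (hΩs : 0 < Ωs) (hγbarRU : 0 < γbarRU)
    (hC : 0 < C)
    (hSR hRU : Ω → ℂ)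
    (lawSR : HasLaw (fun ω => ‖hSR ω‖ ^ 2) (shadowedRicianLaw b Γs Ωsr) P)
    (lawRU : HasLaw (fun ω => ‖hRU ω‖) (fisherLaw m ms Ωm Ωs) P)
    (indep : IndepFun hSR hRU P)
    (γ : ℝ) (hγ : 0 < γ) :
    cdf (P.map fun ω => linkSNR γbarSR (hSR ω)) γ = closedFormSR b Γs Ωsr γbarSR γ ∧
    (∀ i < Γs, MeijerGWellDefined 2 2 (upperParams m i) (lowerParams ms)
      (meijerArg b Γs Ωsr γbarSR m ms Ωm Ωs γbarRU C γ : ℂ)) ∧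
    ((cdf (P.map fun ω => snrAF C (linkSNR γbarSR (hSR ω)) (linkSNR γbarRU (hRU ω))) γ : ℝ) : ℂ) =
      (closedFormSR b Γs Ωsr γbarSR γ : ℂ)
        + (lambdaAF b Γs Ωsr γbarSR m ms γ : ℂ) * ∑ k ∈ Finset.range Γs,
            ((coeffC b Γs Ωsr k / γbarSR ^ (k + 1) : ℝ) : ℂ) *
              ∑ i ∈ Finset.range (k + 1),
                ((k.choose i : ℝ) : ℂ)
                  * ((((betaSR b - deltaSR b Γs Ωsr) / γbarSR) ^ (-((i : ℤ) + 1)) : ℝ) : ℂ)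
                  * ((γ ^ (k - i) : ℝ) : ℂ)
                  * meijerG 2 2 (upperParams m i) (lowerParams ms)
                      (meijerArg b Γs Ωsr γbarSR m ms Ωm Ωs γbarRU C γ : ℂ) := by
  -- The two laws have total mass one because they are laws of random variables; the densities need
  -- not be integrated.
  have hSprob : IsProbabilityMeasure (shadowedRicianLaw b Γs Ωsr) := by
    rw [← lawSR.map_eq]
    exact Measure.isProbabilityMeasure_map lawSR.aemeasurable
  have hRprob : IsProbabilityMeasure (fisherLaw m ms Ωm Ωs) := by
    rw [← lawRU.map_eq]
    exact Measure.isProbabilityMeasure_map lawRU.aemeasurable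
  have hκ : 0 < betaSR b - deltaSR b Γs Ωsr := betaSR_sub_deltaSR_pos hb hΓs hΩsr
  have hz : 0 < meijerArg b Γs Ωsr γbarSR m ms Ωm Ωs γbarRU C γ := by
    unfold meijerArg
    positivity
  have hclosed : (shadowedRicianLaw b Γs Ωsr).real (Set.Iic (γ / γbarSR)) =
      closedFormSR b Γs Ωsr γbarSR γ := by
    rw [measureReal_shadowedRicianLaw_Iic hb hΓs hΩsr (by positivity), closedFormSR]
    simp only [mul_div_assoc]
  refine ⟨?_, fun i _ => meijerGWellDefined hm hms hΩm hΩs hz i, ?_⟩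
  · have haem : AEMeasurable (fun ω => linkSNR γbarSR (hSR ω)) P :=
      lawSR.aemeasurable.const_mul γbarSR
    have := Measure.isProbabilityMeasure_map haem
    rw [cdf_eq_real, map_measureReal_apply_of_aemeasurable haem measurableSet_Iic, ← hclosed,
      ← lawSR.map_eq, map_measureReal_apply_of_aemeasurable lawSR.aemeasurable measurableSet_Iic]
    congr 1
    ext ω
    simp only [Set.mem_preimage, Set.mem_Iic, linkSNR]
    rw [le_div_iff₀ hγbarSR, mul_comm]
  · have hpair : HasLaw (fun ω => (‖hSR ω‖ ^ 2, ‖hRU ω‖))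
        ((shadowedRicianLaw b Γs Ωsr).prod (fisherLaw m ms Ωm Ωs)) P :=
      IndepFun.hasLaw_prod lawSR lawRU
        (indep.comp (φ := fun h : ℂ => ‖h‖ ^ 2) (ψ := fun h : ℂ => ‖h‖) (by fun_prop) (by fun_prop))
    have hsnr : Measurable fun p : ℝ × ℝ => snrAF C (γbarSR * p.1) (γbarRU * p.2 ^ 2) := by
      unfold snrAF
      fun_prop
    have haem : AEMeasurable
        (fun ω => snrAF C (linkSNR γbarSR (hSR ω)) (linkSNR γbarRU (hRU ω))) P :=
      hsnr.comp_aemeasurable hpair.aemeasurable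
    have := Measure.isProbabilityMeasure_map haem
    have hcdf : cdf (P.map fun ω => snrAF C (linkSNR γbarSR (hSR ω)) (linkSNR γbarRU (hRU ω))) γ =
        ((shadowedRicianLaw b Γs Ωsr).prod (fisherLaw m ms Ωm Ωs)).real
          {p | snrAF C (γbarSR * p.1) (γbarRU * p.2 ^ 2) ≤ γ} := by
      rw [cdf_eq_real, map_measureReal_apply_of_aemeasurable haem measurableSet_Iic]
      exact hpair.measureReal_eq (measurableSet_le hsnr measurable_const)
    rw [hcdf, measureReal_prod_snrAF_le hb hΓs hΩsr hγbarSR hm hms hΩm hΩs hγbarRU hC hγ, hclosed]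
    simp only [meijerG_eq hm hms hΩm hΩs hz]
    norm_cast
    congr 1
    have hΓm : Real.Gamma m ≠ 0 := (Real.Gamma_pos_of_pos hm).ne'
    have hΓms : Real.Gamma ms ≠ 0 := (Real.Gamma_pos_of_pos hms).ne'
    rw [lambdaAF, ← mul_assoc, ← mul_div_assoc, Finset.mul_sum, Finset.mul_sum]
    refine Finset.sum_congr rfl fun k _ => ?_
    rw [Finset.mul_sum, Finset.mul_sum, Finset.mul_sum, Finset.mul_sum]
    refine Finset.sum_congr rfl fun i hi => ?_
    have hik : k = i + (k - i) := by
      have := Finset.mem_range.1 hi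
      omega
    rw [zpow_negSucc]
    -- With `k = i + j` the powers of `γbarSR` match: `γbarSR^(i+1) / γbarSR^(k+1) = γbarSR^(-j)`,
    -- the denominator of `(γ/γbarSR)ʲ`.
    generalize k - i = j at *
    subst hik
    generalize ((fisherLaw m ms Ωm Ωs).prod (erlangMeasure i)).real _ = J
    simp only [div_pow, ← mul_div_assoc]
    field_simp
    ring
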